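/- Rings are associative with $1$; $J(R)$ is the Jacobson radical and $U(R)$ the group of units of a ring $R$. For idempotents $e,f\in R$ write $e\sim f$ if $e=u^{-1}fu$ for some $u\in U(R)$. A ring $R$ is called \emph{unit uniquely clean} (UnitUC) if every element of $R$ is the sum of an idempotent and a unit, and whenever $e+u=f+v$ with $e,f$ idempotents and $u,v\in U(R)$, then $e\sim f$. A \emph{Morita context} consists of rings $A,B$, an $(A,B)$-bimodule $M$, a $(B,A)$-bimodule $N$, and bimodule homomorphisms $\varphi:M\otimes_B N\to A$ and $\psi:N\otimes_A M\to B$, written $mn=\varphi(m\otimes n)$ and $nm=\psi(n\otimes m)$, such that $(mn)m'=m(nm')$ and $(nm)n'=n(mn')$ for all $m,m'\in M$ and $n,n'\in N$. Then the set $\begin{pmatrix}A&M\\N&B\end{pmatrix}$ is a ring under the usual matrix operations, the \emph{Morita context ring}. Put $MN=\operatorname{Im}\varphi$ and $NM=\operatorname{Im}\psi$. **Theorem.** 1. The Morita context ring $\begin{pmatrix}A&M\\N&B\end{pmatrix}$ is UnitUC if and only if $A$ and $B$ are UnitUC, $MN\subseteq J(A)$ and $NM\subseteq J(B)$. 2.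 Let $R$ be a ring and $e\in R$ an idempotent. Then $R$ is UnitUC if and only if $eRe$ and $(1-e)R(1-e)$ are UnitUC and $eR(1-e)\subseteq J(R)$, $(1-e)Re\subseteq J(R)$. 3. Let $R,S$ be rings and $M$ an $(R,S)$-bimodule. The formal triangular matrix ring $\begin{pmatrix}R&M\\0&S\end{pmatrix}$ is UnitUC if and only if $R$ and $S$ are UnitUC. 4. Let $K$ be a ring and $n\ge 1$. The ring $T_n(K)$ of upper triangular $n\times n$ matrices over $K$ is UnitUC if and only if $K$ is UnitUC. 5. Let $R$ be a ring and $s$ a central element of $R$. Let $K_s(R)$ be the ring of all $2\times 2$ arrays over $R$ with componentwise addition and the multiplication $$\begin{pmatrix}a_1&x_1\\y_1&b_1\end{pmatrix}\begin{pmatrix}a_2&x_2\\y_2&b_2\end{pmatrix}=\begin{pmatrix}a_1a_2+sx_1y_2&a_1x_2+x_1b_2\\y_1a_2+b_1y_2&sy_1x_2+b_1b_2\end{pmatrix}.$$ Then $K_s(R)$ is UnitUC if and only if $R$ is UnitUC and $s\in J(R)$. 6. Let $R$ be a ring. Then $K_2(R)$ (the case $s=2=1+1$) is UnitUC if and only if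 $R$ is UnitUC. -/

import Mathlib

open scoped RightActions

/-- Two elements `e` and `f` (in practice idempotents) of a ring are equivalent, `e ∼ f`, if
`e = u⁻¹ f u` for some unit `u`. -/
def UnitEquiv {R : Type*} [Ring R] (e f : R) : Prop :=
  ∃ u : Rˣ, e = (↑u⁻¹ : R) * f * (u : R)

/-- A ring is clean if each of its elements is the sum of an idempotent and a unit. -/
def IsCleanRing (R : Type*) [Ring R] : Prop :=
  ∀ a : R, ∃ e u : R, IsIdempotentElem e ∧ IsUnit u ∧ a = e + u

/-- A ring is unit uniquely clean if it is clean and the idempotents in any two clean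
representations `e + u = f + v` of the same element are equivalent. -/
structure IsUnitUC (R : Type*) [Ring R] : Prop where
  clean : IsCleanRing R
  unique : ∀ e f u v : R, IsIdempotentElem e → IsIdempotentElem f → IsUnit u → IsUnit v →
    e + u = f + v → UnitEquiv e f

/-! ### Morita context rings

A right module over `B` is a module over `Bᵐᵒᵖ`, and `m <• b` is the right action. -/

/-- A Morita context `(A, B, M, N, φ, ψ)`. Here `φ` is a homomorphism of `(A, A)`-bimodules from
`M ⊗ N` (tensor product over `B`) to `A`, given as a biadditive `B`-balanced map on pairs that is
linear on both sides, `ψ` is likewise a homomorphism of `(B, B)`-bimodules from `N ⊗ M` (tensor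
product over `A`) to `B`, and the two associativity conditions hold. -/
structure MoritaContext (A B M N : Type*) [Ring A] [Ring B] [AddCommGroup M] [AddCommGroup N]
    [Module A M] [Module Bᵐᵒᵖ M] [SMulCommClass A Bᵐᵒᵖ M]
    [Module B N] [Module Aᵐᵒᵖ N] [SMulCommClass B Aᵐᵒᵖ N] where
  φ : M →+ N →+ A
  ψ : N →+ M →+ B
  φ_balanced : ∀ (m : M) (b : B) (n : N), φ (m <• b) n = φ m (b • n)
  φ_left : ∀ (a : A) (m : M) (n : N), φ (a • m) n = a * φ m n
  φ_right : ∀ (m : M) (n : N) (a : A), φ m (n <• a) = φ m n * a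
  ψ_balanced : ∀ (n : N) (a : A) (m : M), ψ (n <• a) m = ψ n (a • m)
  ψ_left : ∀ (b : B) (n : N) (m : M), ψ (b • n) m = b * ψ n m
  ψ_right : ∀ (n : N) (m : M) (b : B), ψ n (m <• b) = ψ n m * b
  assoc_M : ∀ (m : M) (n : N) (m' : M), φ m n • m' = m <• ψ n m'
  assoc_N : ∀ (n : N) (m : M) (n' : N), ψ n m • n' = n <• φ m n'

namespace MoritaContext

variable {A B M N : Type*} [Ring A] [Ring B] [AddCommGroup M] [AddCommGroup N]
  [Module A M] [Module Bᵐᵒᵖ M] [SMulCommClass A Bᵐᵒᵖ M]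
  [Module B N] [Module Aᵐᵒᵖ N] [SMulCommClass B Aᵐᵒᵖ N]

/-- The trace ideal `MN`, the image of `φ` on the tensor product: all finite sums of products
`φ(m, n)`. -/
def traceMN (C : MoritaContext A B M N) : AddSubgroup A :=
  AddSubgroup.closure {a | ∃ (m : M) (n : N), a = C.φ m n}

/-- The trace ideal `NM`, the image of `ψ` on the tensor product: all finite sums of products
`ψ(n, m)`. -/
def traceNM (C : MoritaContext A B M N) : AddSubgroup B :=
  AddSubgroup.closure {b | ∃ (n : N) (m : M), b = C.ψ n m}

/-- The underlying type of the Morita context ring: `2 × 2` matrices with rows `(a, m)` and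
`(n, b)`. -/
@[ext]
structure MatrixRing (C : MoritaContext A B M N) where
  a : A
  m : M
  n : N
  b : B

namespace MatrixRing

variable {C : MoritaContext A B M N}

instance : Zero (MatrixRing C) := ⟨⟨0, 0, 0, 0⟩⟩
instance : One (MatrixRing C) := ⟨⟨1, 0, 0, 1⟩⟩
instance : Add (MatrixRing C) := ⟨fun x y => ⟨x.a + y.a, x.m + y.m, x.n + y.n, x.b + y.b⟩⟩
instance : Neg (MatrixRing C) := ⟨fun x => ⟨-x.a, -x.m, -x.n, -x.b⟩⟩
instance : Mul (MatrixRing C) := ⟨fun x y =>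
  ⟨x.a * y.a + C.φ x.m y.n, x.a • y.m + x.m <• y.b, x.n <• y.a + x.b • y.n,
    C.ψ x.n y.m + x.b * y.b⟩⟩

@[simp] theorem zero_a : (0 : MatrixRing C).a = 0 := rfl
@[simp] theorem zero_m : (0 : MatrixRing C).m = 0 := rfl
@[simp] theorem zero_n : (0 : MatrixRing C).n = 0 := rfl
@[simp] theorem zero_b : (0 : MatrixRing C).b = 0 := rfl
@[simp] theorem one_a : (1 : MatrixRing C).a = 1 := rfl
@[simp] theorem one_m : (1 : MatrixRing C).m = 0 := rfl
@[simp] theorem one_n : (1 : MatrixRing C).n = 0 := rfl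
@[simp] theorem one_b : (1 : MatrixRing C).b = 1 := rfl
@[simp] theorem add_a (x y : MatrixRing C) : (x + y).a = x.a + y.a := rfl
@[simp] theorem add_m (x y : MatrixRing C) : (x + y).m = x.m + y.m := rfl
@[simp] theorem add_n (x y : MatrixRing C) : (x + y).n = x.n + y.n := rfl
@[simp] theorem add_b (x y : MatrixRing C) : (x + y).b = x.b + y.b := rfl
@[simp] theorem neg_a (x : MatrixRing C) : (-x).a = -x.a := rfl
@[simp] theorem neg_m (x : MatrixRing C) : (-x).m = -x.m := rfl
@[simp] theorem neg_n (x : MatrixRing C) : (-x).n = -x.n := rfl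
@[simp] theorem neg_b (x : MatrixRing C) : (-x).b = -x.b := rfl
@[simp] theorem mul_a (x y : MatrixRing C) : (x * y).a = x.a * y.a + C.φ x.m y.n := rfl
@[simp] theorem mul_m (x y : MatrixRing C) : (x * y).m = x.a • y.m + x.m <• y.b := rfl
@[simp] theorem mul_n (x y : MatrixRing C) : (x * y).n = x.n <• y.a + x.b • y.n := rfl
@[simp] theorem mul_b (x y : MatrixRing C) : (x * y).b = C.ψ x.n y.m + x.b * y.b := rfl

theorem mul_assoc' (x y z : MatrixRing C) : x * y * z = x * (y * z) := by
  ext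
  · simp only [mul_a, mul_m, mul_n, map_add, AddMonoidHom.add_apply, C.φ_left, C.φ_right,
      C.φ_balanced, add_mul, mul_add, mul_assoc]
    abel
  · simp only [mul_a, mul_m, mul_b, add_smul, smul_add, C.assoc_M, MulOpposite.op_add,
      MulOpposite.op_mul, mul_smul, smul_comm x.a]
    abel
  · simp only [mul_a, mul_n, mul_b, add_smul, smul_add, C.assoc_N, MulOpposite.op_add,
      MulOpposite.op_mul, mul_smul, smul_comm x.b]
    abel
  · simp only [mul_b, mul_m, mul_n, map_add, AddMonoidHom.add_apply, C.ψ_left, C.ψ_right,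
      C.ψ_balanced, add_mul, mul_add, mul_assoc]
    abel

/-- The Morita context ring. -/
instance : Ring (MatrixRing C) where
  add_assoc x y z := by ext <;> simp [add_assoc]
  zero_add x := by ext <;> simp
  add_zero x := by ext <;> simp
  add_comm x y := by ext <;> simp [add_comm]
  neg_add_cancel x := by ext <;> simp
  nsmul := nsmulRec
  zsmul := zsmulRec
  mul_assoc := mul_assoc'
  one_mul x := by ext <;> simp
  mul_one x := by ext <;> simp
  zero_mul x := by ext <;> simp
  mul_zero x := by ext <;> simp
  left_distrib x y z := by ext <;> simp [mul_add, add_smul] <;> abel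
  right_distrib x y z := by ext <;> simp [add_mul, add_smul] <;> abel

end MatrixRing

end MoritaContext

/-! ### Formal triangular matrix rings -/

/-- The formal triangular matrices with rows `(r, m)` and `(0, s)`. -/
@[ext]
structure FormalTriangular (R S M : Type*) where
  r : R
  m : M
  s : S

namespace FormalTriangular

variable {R S M : Type*} [Ring R] [Ring S] [AddCommGroup M]

instance : Zero (FormalTriangular R S M) := ⟨⟨0, 0, 0⟩⟩
instance : One (FormalTriangular R S M) := ⟨⟨1, 0, 1⟩⟩
instance : Add (FormalTriangular R S M) := ⟨fun x y => ⟨x.r + y.r, x.m + y.m, x.s + y.s⟩⟩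
instance : Neg (FormalTriangular R S M) := ⟨fun x => ⟨-x.r, -x.m, -x.s⟩⟩

@[simp] theorem zero_r : (0 : FormalTriangular R S M).r = 0 := rfl
@[simp] theorem zero_m : (0 : FormalTriangular R S M).m = 0 := rfl
@[simp] theorem zero_s : (0 : FormalTriangular R S M).s = 0 := rfl
@[simp] theorem one_r : (1 : FormalTriangular R S M).r = 1 := rfl
@[simp] theorem one_m : (1 : FormalTriangular R S M).m = 0 := rfl
@[simp] theorem one_s : (1 : FormalTriangular R S M).s = 1 := rfl
@[simp] theorem add_r (x y : FormalTriangular R S M) : (x + y).r = x.r + y.r := rfl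
@[simp] theorem add_m (x y : FormalTriangular R S M) : (x + y).m = x.m + y.m := rfl
@[simp] theorem add_s (x y : FormalTriangular R S M) : (x + y).s = x.s + y.s := rfl
@[simp] theorem neg_r (x : FormalTriangular R S M) : (-x).r = -x.r := rfl
@[simp] theorem neg_m (x : FormalTriangular R S M) : (-x).m = -x.m := rfl
@[simp] theorem neg_s (x : FormalTriangular R S M) : (-x).s = -x.s := rfl

variable [Module R M] [Module Sᵐᵒᵖ M]

instance : Mul (FormalTriangular R S M) :=
  ⟨fun x y => ⟨x.r * y.r, x.r • y.m + x.m <• y.s, x.s * y.s⟩⟩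

@[simp] theorem mul_r (x y : FormalTriangular R S M) : (x * y).r = x.r * y.r := rfl
@[simp] theorem mul_m (x y : FormalTriangular R S M) :
    (x * y).m = x.r • y.m + x.m <• y.s := rfl
@[simp] theorem mul_s (x y : FormalTriangular R S M) : (x * y).s = x.s * y.s := rfl

/-- The formal triangular matrix ring `T(R, S, M)` of an `(R, S)`-bimodule `M`. -/
instance [SMulCommClass R Sᵐᵒᵖ M] : Ring (FormalTriangular R S M) where
  add_assoc x y z := by ext <;> simp [add_assoc]
  zero_add x := by ext <;> simp
  add_zero x := by ext <;> simp
  add_comm x y := by ext <;> simp [add_comm]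
  neg_add_cancel x := by ext <;> simp
  nsmul := nsmulRec
  zsmul := zsmulRec
  mul_assoc x y z := by
    ext
    · simp [mul_assoc]
    · simp only [mul_r, mul_m, mul_s, smul_add, MulOpposite.op_mul, mul_smul, smul_comm x.r]
      abel
    · simp [mul_assoc]
  one_mul x := by ext <;> simp
  mul_one x := by ext <;> simp
  zero_mul x := by ext <;> simp
  mul_zero x := by ext <;> simp
  left_distrib x y z := by ext <;> simp [mul_add, add_smul] <;> abel
  right_distrib x y z := by ext <;> simp [add_mul, add_smul] <;> abel

end FormalTriangular

/-- The ring `T_n(K)` of upper triangular `n × n` matrices over `K`. -/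
def upperTriangularSubring (K : Type*) [Ring K] (n : ℕ) : Subring (Matrix (Fin n) (Fin n) K) where
  carrier := {X | X.IsUpperTriangular}
  zero_mem' := Matrix.blockTriangular_zero
  one_mem' := Matrix.blockTriangular_one
  mul_mem' := Matrix.BlockTriangular.mul
  add_mem' := Matrix.BlockTriangular.add
  neg_mem' := Matrix.BlockTriangular.neg

/-! ### The rings `K_s(R)` -/

/-- The underlying type of `K_s(R)`, for a central element `s`: `2 × 2` matrices with rows `(a, x)`
and `(y, b)`. -/
@[ext]
structure KRing (R : Type*) [Ring R] (s : Subring.center R) where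
  a : R
  x : R
  y : R
  b : R

namespace KRing

variable {R : Type*} [Ring R] {s : Subring.center R}

instance : Zero (KRing R s) := ⟨⟨0, 0, 0, 0⟩⟩
instance : One (KRing R s) := ⟨⟨1, 0, 0, 1⟩⟩
instance : Add (KRing R s) := ⟨fun p q => ⟨p.a + q.a, p.x + q.x, p.y + q.y, p.b + q.b⟩⟩
instance : Neg (KRing R s) := ⟨fun p => ⟨-p.a, -p.x, -p.y, -p.b⟩⟩
instance : Mul (KRing R s) := ⟨fun p q =>
  ⟨p.a * q.a + s * p.x * q.y, p.a * q.x + p.x * q.b, p.y * q.a + p.b * q.y,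
    s * p.y * q.x + p.b * q.b⟩⟩

@[simp] theorem zero_a : (0 : KRing R s).a = 0 := rfl
@[simp] theorem zero_x : (0 : KRing R s).x = 0 := rfl
@[simp] theorem zero_y : (0 : KRing R s).y = 0 := rfl
@[simp] theorem zero_b : (0 : KRing R s).b = 0 := rfl
@[simp] theorem one_a : (1 : KRing R s).a = 1 := rfl
@[simp] theorem one_x : (1 : KRing R s).x = 0 := rfl
@[simp] theorem one_y : (1 : KRing R s).y = 0 := rfl
@[simp] theorem one_b : (1 : KRing R s).b = 1 := rfl
@[simp] theorem add_a (p q : KRing R s) : (p + q).a = p.a + q.a := rfl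
@[simp] theorem add_x (p q : KRing R s) : (p + q).x = p.x + q.x := rfl
@[simp] theorem add_y (p q : KRing R s) : (p + q).y = p.y + q.y := rfl
@[simp] theorem add_b (p q : KRing R s) : (p + q).b = p.b + q.b := rfl
@[simp] theorem neg_a (p : KRing R s) : (-p).a = -p.a := rfl
@[simp] theorem neg_x (p : KRing R s) : (-p).x = -p.x := rfl
@[simp] theorem neg_y (p : KRing R s) : (-p).y = -p.y := rfl
@[simp] theorem neg_b (p : KRing R s) : (-p).b = -p.b := rfl
@[simp] theorem mul_a (p q : KRing R s) : (p * q).a = p.a * q.a + s * p.x * q.y := rfl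
@[simp] theorem mul_x (p q : KRing R s) : (p * q).x = p.a * q.x + p.x * q.b := rfl
@[simp] theorem mul_y (p q : KRing R s) : (p * q).y = p.y * q.a + p.b * q.y := rfl
@[simp] theorem mul_b (p q : KRing R s) : (p * q).b = s * p.y * q.x + p.b * q.b := rfl

theorem left_comm (s : Subring.center R) (r t : R) : r * (s * t) = s * (r * t) := by
  rw [← mul_assoc, Subring.mem_center_iff.mp s.2 r, mul_assoc]

/-- The ring `K_s(R)`. -/
instance : Ring (KRing R s) where
  add_assoc p q r := by ext <;> simp [add_assoc]
  zero_add p := by ext <;> simp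
  add_zero p := by ext <;> simp
  add_comm p q := by ext <;> simp [add_comm]
  neg_add_cancel p := by ext <;> simp
  nsmul := nsmulRec
  zsmul := zsmulRec
  mul_assoc p q r := by
    ext <;> simp only [mul_a, mul_x, mul_y, mul_b, add_mul, mul_add, mul_assoc, left_comm] <;> abel
  one_mul p := by ext <;> simp
  mul_one p := by ext <;> simp
  zero_mul p := by ext <;> simp
  mul_zero p := by ext <;> simp
  left_distrib p q r := by ext <;> simp [mul_add] <;> abel
  right_distrib p q r := by ext <;> simp [add_mul, mul_add] <;> abel

end KRing

/-!
The whole theorem follows from one structural fact, `isUnitUC_iff_isSemiboolean`: a ring `R` is unit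
uniquely clean exactly when every element is an idempotent modulo `J(R)`, i.e. when each `a : R` has
the form `e + j` with `e` idempotent and `j ∈ J(R)` (`R` is *semiboolean*).

If `R` is semiboolean, then `R / J(R)` is Boolean, so all units are `1` modulo `J(R)`. Hence the
idempotents in two clean representations of the same element agree modulo `J(R)`, and idempotents
which agree modulo `J(R)` are conjugate (`unitEquiv_of_sub_mem_ringJacobson`).

Conversely, let `R` be unit uniquely clean. Comparing `u = 0 + u` with `u = f + v` shows that no
unit is the sum of a nonzero idempotent `f` and a unit `v`. As clean rings lift idempotents
(`IsCleanRing.exists_isIdempotentElem_sub_eq`), this property passes to `Q = R / J(R)`. Every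
nonzero left ideal of the clean ring `Q` contains a nonzero idempotent, so a nonzero element of
square zero would produce `2 × 2` matrix units. The matrix with rows `(0, -1)` and `(1, 1)` and its
difference with the identity are both invertible, contradicting the property. So `Q` is reduced,
its idempotents are central, and the same argument in a corner shows that its only unit is `1`.
Since `Q` is clean, all its elements are idempotent.

For an idempotent `e` one has `J(eRe) = J(R) ∩ eRe`
(`IsIdempotentElem.mem_ringJacobson_corner_iff`), which gives the Peirce decomposition criterion
`IsIdempotentElem.isSemiboolean_iff_corner`: the off-diagonal parts consist of elements of square
zero, which lie in the radical of a semiboolean ring. Applied to the idempotent with rows `(1, 0)`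
and `(0, 0)` it yields the criterion for Morita context rings, of which the rings `K_s(R)` are an
example. The triangular matrix rings map onto their diagonals by split surjections with kernel in
the radical, along which the semiboolean property passes both ways (`isSemiboolean_iff_of_split`).
-/

/-! ### Jacobson radical of a noncommutative ring -/

section JacobsonRadical

variable {R : Type*} [Ring R]

theorem mem_ringJacobson_iff_exists_mul_eq_one {x : R} :
    x ∈ Ring.jacobson R ↔ ∀ y, ∃ z, z * (1 + y * x) = 1 := by
  rw [← Ideal.jacobson_bot, Ideal.mem_jacobson_iff]
  refine forall_congr' fun y => exists_congr fun z => ?_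
  rw [Submodule.mem_bot, sub_eq_zero, mul_add, mul_one, mul_assoc, add_comm]

theorem isUnit_one_add_of_mem_ringJacobson {x : R} (hx : x ∈ Ring.jacobson R) :
    IsUnit (1 + x) := by
  obtain ⟨z, hz⟩ := mem_ringJacobson_iff_exists_mul_eq_one.1 hx 1
  rw [one_mul] at hz
  obtain ⟨w, hw⟩ := mem_ringJacobson_iff_exists_mul_eq_one.1 hx (-z)
  -- `z = 1 - z * x` has a left inverse as well, so `z` is a unit with inverse `1 + x`
  have hz' : 1 + -z * x = z := by
    rw [← hz]; noncomm_ring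
  rw [hz'] at hw
  have : w = 1 + x := left_inv_eq_right_inv hw hz
  exact ⟨⟨1 + x, z, by rw [← this, hw], hz⟩, rfl⟩

theorem mem_ringJacobson_iff_isUnit {x : R} :
    x ∈ Ring.jacobson R ↔ ∀ y, IsUnit (1 + y * x) :=
  ⟨fun hx y => isUnit_one_add_of_mem_ringJacobson (Ideal.mul_mem_left _ y hx), fun h =>
    mem_ringJacobson_iff_exists_mul_eq_one.2 fun y => (h y).exists_left_inv⟩

theorem isUnit_of_sub_mem_ringJacobson {a u : R} (hu : IsUnit u) (h : a - u ∈ Ring.jacobson R) :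
    IsUnit a := by
  obtain ⟨u, rfl⟩ := hu
  have h1 := isUnit_one_add_of_mem_ringJacobson (Ideal.mul_mem_left _ (↑u⁻¹ : R) h)
  have h2 : a = u * (1 + ↑u⁻¹ * (a - u)) := by
    rw [mul_add, Units.mul_inv_cancel_left]; simp
  rw [h2]
  exact u.isUnit.mul h1

theorem map_mem_ringJacobson {S : Type*} [Ring S] {f : R →+* S} (hf : Function.Surjective f)
    {x : R} (hx : x ∈ Ring.jacobson R) : f x ∈ Ring.jacobson S := by
  have : RingHomSurjective f := ⟨hf⟩
  exact Ring.le_comap_jacobson f hx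

theorem map_mem_ringJacobson_iff {S : Type*} [Ring S] {f : R →+* S} (hf : Function.Surjective f)
    (hker : ∀ x, f x = 0 → x ∈ Ring.jacobson R) {x : R} :
    f x ∈ Ring.jacobson S ↔ x ∈ Ring.jacobson R := by
  refine ⟨fun hx => ?_, map_mem_ringJacobson hf⟩
  rw [mem_ringJacobson_iff_exists_mul_eq_one] at hx ⊢
  intro y
  obtain ⟨z, hz⟩ := hx (f y)
  obtain ⟨z, rfl⟩ := hf z
  have h : IsUnit (z * (1 + y * x)) :=
    isUnit_of_sub_mem_ringJacobson isUnit_one (hker _ (by simp [hz]))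
  obtain ⟨w, hw⟩ := h.exists_left_inv
  exact ⟨w * z, by rw [mul_assoc, hw]⟩

/-- A unit of `R / J(R)` lifts only to units of `R`. -/
theorem isUnit_of_isUnit_mk_ringJacobson {a : R}
    (h : IsUnit (Ideal.Quotient.mk (Ring.jacobson R) a)) : IsUnit a := by
  obtain ⟨b, hb, hb'⟩ := isUnit_iff_exists.1 h
  obtain ⟨b, rfl⟩ := Ideal.Quotient.mk_surjective b
  rw [← map_mul, ← map_one (Ideal.Quotient.mk _), Ideal.Quotient.mk_eq_mk_iff_sub_mem] at hb hb'
  obtain ⟨c, hc⟩ := (isUnit_of_sub_mem_ringJacobson isUnit_one hb).exists_right_inv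
  obtain ⟨d, hd⟩ := (isUnit_of_sub_mem_ringJacobson isUnit_one hb').exists_left_inv
  rw [mul_assoc] at hc
  rw [← mul_assoc] at hd
  exact isUnit_iff_exists_and_exists.2 ⟨⟨_, hc⟩, ⟨_, hd⟩⟩

/-- Idempotents which agree modulo the Jacobson radical are conjugate, by the unit
`f * e + (1 - f) * (1 - e)`. -/
theorem unitEquiv_of_sub_mem_ringJacobson {e f : R} (he : IsIdempotentElem e)
    (hf : IsIdempotentElem f) (h : e - f ∈ Ring.jacobson R) : UnitEquiv e f := by
  have hu : IsUnit (f * e + (1 - f) * (1 - e)) := by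
    refine isUnit_of_sub_mem_ringJacobson isUnit_one ?_
    have h1 : f * e + (1 - f) * (1 - e) - 1 = f * (e - f) - (1 - f) * (e - f) := by
      simp only [mul_sub, sub_mul, mul_one, one_mul, hf.eq]
      abel
    rw [h1]
    exact sub_mem (Ideal.mul_mem_left _ _ h) (Ideal.mul_mem_left _ _ h)
  obtain ⟨u, hu⟩ := hu
  refine ⟨u, ?_⟩
  have h2 : f * (u : R) = u * e := by
    simp only [hu, mul_sub, sub_mul, mul_add, add_mul, mul_one, one_mul, mul_assoc, he.eq]
    simp only [← mul_assoc, hf.eq]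
    abel
  rw [mul_assoc, h2, Units.inv_mul_cancel_left]

end JacobsonRadical

/-! ### Clean rings and idempotents -/

section Clean

variable {R : Type*} [Ring R]

/-- In a clean ring every `a` differs from some idempotent by a left multiple of `a ^ 2 - a`:
if `a = e + u`, the idempotent is `u⁻¹ * (1 - e) * u`. In particular idempotents lift modulo every
left ideal. -/
theorem IsCleanRing.exists_isIdempotentElem_sub_eq (h : IsCleanRing R) (a : R) :
    ∃ e u g : R, IsIdempotentElem e ∧ IsUnit u ∧ a = e + u ∧ IsIdempotentElem g ∧
      (g = 0 → e = 1) ∧ ∃ c, a - g = c * (a * a - a) := by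
  obtain ⟨e, _, he, ⟨u, rfl⟩, rfl⟩ := h a
  refine ⟨e, u, ↑u⁻¹ * (1 - e) * u, he, u.isUnit, rfl, ?_, fun h0 => ?_, ↑u⁻¹, ?_⟩
  · unfold IsIdempotentElem
    simp only [mul_assoc, Units.mul_inv_cancel_left]
    rw [← mul_assoc (1 - e) (1 - e), he.one_sub.eq]
  · rw [Units.mul_left_eq_zero, Units.mul_right_eq_zero, sub_eq_zero] at h0
    exact h0.symm
  · have : (e + u) * (e + u) - (e + u) = u * (e + u) - (1 - e) * u := by
      simp only [mul_add, add_mul, sub_mul, he.eq, one_mul]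
      abel
    rw [this, mul_sub (↑u⁻¹ : R) (↑u * (e + ↑u)), Units.inv_mul_cancel_left, mul_assoc]

/-- In a clean ring, every left ideal not contained in the Jacobson radical contains a nonzero
idempotent. -/
theorem IsCleanRing.exists_isIdempotentElem_of_notMem (h : IsCleanRing R) {x : R}
    (hx : x ∉ Ring.jacobson R) : ∃ y, IsIdempotentElem (y * x) ∧ y * x ≠ 0 := by
  by_contra! hc
  refine hx (mem_ringJacobson_iff_isUnit.2 fun y => ?_)
  obtain ⟨e, u, g, he, hu, ha, hg, hg0, c, hgc⟩ :=
    h.exists_isIdempotentElem_sub_eq (-(y * x))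
  have hgx : (-(y + c * (y * x * y + y))) * x = g := by
    have : g = -(y * x) - c * (-(y * x) * -(y * x) - -(y * x)) := by rw [← hgc]; abel
    rw [this]; noncomm_ring
  have h0 : g = 0 := by rw [← hgx]; exact hc _ (by rwa [hgx])
  rw [hg0 h0] at ha
  have : 1 + y * x = -u := by
    rw [← neg_neg (y * x), ha]; abel
  rw [this]
  exact hu.neg

end Clean

/-! ### Semiboolean rings -/

/-- A ring is semiboolean if every element is the sum of an idempotent and an element of the
Jacobson radical; equivalently, `R / J(R)` is Boolean and idempotents lift modulo `J(R)`. -/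
def IsSemiboolean (R : Type*) [Ring R] : Prop :=
  ∀ a : R, ∃ e : R, IsIdempotentElem e ∧ a - e ∈ Ring.jacobson R

section NoSumOfUnits

variable {Q : Type*} [Ring Q]

/-- If a ring has no nonzero idempotent `f` with `f + v` a unit for a unit `v`, then no corner
`gQg` with `g ≠ 0` contains a root of `X ^ 2 - X + 1`. -/
theorem eq_zero_of_mul_self_eq_sub
    (h : ∀ f v : Q, IsIdempotentElem f → IsUnit v → IsUnit (f + v) → f = 0)
    {g w : Q} (hg : IsIdempotentElem g) (hgw : g * w = w) (hwg : w * g = w)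
    (hw : w * w = w - g) : g = 0 := by
  -- in the corner, `w` and `w - g` are units with inverses `g - w` and `-w`
  refine h g (w - g + (1 - g)) hg ?_ ?_
  · refine isUnit_iff_exists.2 ⟨1 - g - w, ?_, ?_⟩ <;>
    · simp only [mul_add, add_mul, mul_sub, sub_mul, mul_one, one_mul, hgw, hwg, hw, hg.eq]
      abel
  · refine isUnit_iff_exists.2 ⟨1 - w, ?_, ?_⟩ <;>
    · simp only [mul_add, add_mul, mul_sub, sub_mul, mul_one, one_mul, hgw, hwg, hw]
      abel

/-- Under the same hypothesis a semiprimitive clean ring is reduced. A nonzero element of square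
zero yields nonzero `2 × 2` matrix units, and already among the integral combinations of these there
is a root of `X ^ 2 - X + 1`, namely the matrix with rows `(0, -1)` and `(1, 1)`. -/
theorem IsCleanRing.eq_zero_of_mul_self_eq_zero (hc : IsCleanRing Q) (hJ : Ring.jacobson Q = ⊥)
    (h : ∀ f v : Q, IsIdempotentElem f → IsUnit v → IsUnit (f + v) → f = 0)
    {x : Q} (hx : x * x = 0) : x = 0 := by
  by_contra hx0
  obtain ⟨y, hy, hy0⟩ := hc.exists_isIdempotentElem_of_notMem (x := x) (by rwa [hJ])
  -- `e`, `x * e`, `e * y * (1 - e)` and their product `f` are the matrix units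
  obtain ⟨e, he⟩ : ∃ e, e = y * x := ⟨_, rfl⟩
  rw [← he] at hy hy0
  have hex : e * x = 0 := by rw [he, mul_assoc, hx, mul_zero]
  obtain ⟨p, hp⟩ : ∃ p, p = x * e := ⟨_, rfl⟩
  obtain ⟨q, hq⟩ : ∃ q, q = e * y * (1 - e) := ⟨_, rfl⟩
  have hep : e * p = 0 := by rw [hp, ← mul_assoc, hex, zero_mul]
  have hpe : p * e = p := by rw [hp, mul_assoc, hy.eq]
  have heq : e * q = q := by rw [hq, ← mul_assoc, ← mul_assoc, hy.eq]
  have hqe : q * e = 0 := by rw [hq, mul_assoc, sub_mul, hy.eq, one_mul, sub_self, mul_zero]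
  have hqp : q * p = e := by
    rw [hq, mul_assoc, sub_mul, hep, one_mul, sub_zero, hp, mul_assoc e, ← mul_assoc y, ← he,
      hy.eq, hy.eq]
  have hpp : p * p = 0 := by rw [← hpe, mul_assoc, hpe, hep, mul_zero]
  have hqq : q * q = 0 := by nth_rw 2 [← heq]; rw [← mul_assoc, hqe, zero_mul]
  have hpqp : p * q * p = p := by rw [mul_assoc, hqp, hpe]
  have hqpq : q * (p * q) = q := by rw [← mul_assoc, hqp, heq]
  have hppq : p * (p * q) = 0 := by rw [← mul_assoc, hpp, zero_mul]
  have hpqq : p * q * q = 0 := by rw [mul_assoc, hqq, mul_zero]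
  have hepq : e * (p * q) = 0 := by rw [← mul_assoc, hep, zero_mul]
  have hpqe : p * q * e = 0 := by rw [mul_assoc, hqe, mul_zero]
  have hpqpq : p * q * (p * q) = p * q := by rw [← mul_assoc, hpqp]
  have hg : e + p * q = 0 := by
    refine eq_zero_of_mul_self_eq_sub h (g := e + p * q) (w := p - q + p * q) ?_ ?_ ?_ ?_
    · simp only [IsIdempotentElem, mul_add, add_mul, hy.eq, hepq, hpqe, hpqpq]
      abel
    · simp only [mul_add, add_mul, mul_sub, hep, heq, hepq, hpqp, hpqq, hpqpq]
      abel
    · simp only [mul_add, add_mul, sub_mul, hpe, hqe, hpqe, hppq, hqpq, hpqpq]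
      abel
    · simp only [mul_add, add_mul, mul_sub, sub_mul, hpp, hqq, hqp, hppq, hqpq, hpqp, hpqq, hpqpq]
      abel
  apply hy0
  have h1 : e * (e + p * q) = e := by rw [mul_add, hy.eq, hepq, add_zero]
  rw [← h1, hg, mul_zero]

/-- In a semiprimitive clean ring with no nonzero idempotent `f` such that `f + v` is a unit for
a unit `v`, idempotents are central. -/
theorem IsCleanRing.mul_comm_of_isIdempotentElem (hc : IsCleanRing Q) (hJ : Ring.jacobson Q = ⊥)
    (h : ∀ f v : Q, IsIdempotentElem f → IsUnit v → IsUnit (f + v) → f = 0)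
    {e : Q} (he : IsIdempotentElem e) (x : Q) : e * x = x * e := by
  have hee : (1 - e) * e = 0 := by rw [sub_mul, he.eq, one_mul, sub_self]
  have hee' : e * (1 - e) = 0 := by rw [mul_sub, he.eq, mul_one, sub_self]
  have h1 : e * x * (1 - e) = 0 := hc.eq_zero_of_mul_self_eq_zero hJ h <| by
    calc e * x * (1 - e) * (e * x * (1 - e)) = e * x * ((1 - e) * e) * x * (1 - e) := by
          simp only [mul_assoc]
      _ = 0 := by simp [hee]
  have h2 : (1 - e) * x * e = 0 := hc.eq_zero_of_mul_self_eq_zero hJ h <| by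
    calc (1 - e) * x * e * ((1 - e) * x * e) = (1 - e) * x * (e * (1 - e)) * x * e := by
          simp only [mul_assoc]
      _ = 0 := by simp [hee']
  rw [mul_sub, mul_one, sub_eq_zero] at h1
  rw [sub_mul, sub_mul, one_mul, sub_eq_zero] at h2
  rw [h1, h2]

/-- Under the same hypothesis, `1` is the only unit of a semiprimitive clean ring: otherwise the left
ideal of `1 - u` contains a nonzero idempotent `e`, in whose corner `u` and `1 - u` are both
invertible. -/
theorem IsCleanRing.eq_one_of_isUnit (hc : IsCleanRing Q) (hJ : Ring.jacobson Q = ⊥)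
    (h : ∀ f v : Q, IsIdempotentElem f → IsUnit v → IsUnit (f + v) → f = 0)
    {u : Q} (hu : IsUnit u) : u = 1 := by
  by_contra hne
  obtain ⟨r, he, he0⟩ := hc.exists_isIdempotentElem_of_notMem (x := 1 - u) (by
    rw [hJ, Submodule.mem_bot, sub_eq_zero]; exact Ne.symm hne)
  obtain ⟨e, hre⟩ : ∃ e, e = r * (1 - u) := ⟨_, rfl⟩
  rw [← hre] at he he0
  have hcomm := hc.mul_comm_of_isIdempotentElem hJ h he
  have hee' : e * (1 - e) = 0 := by rw [mul_sub, he.eq, mul_one, sub_self]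
  -- both `u` and `1 - u` become units in the corner of the central idempotent `e`
  refine he0 (h e ((u - 1) * e + (1 - e)) he ?_ ?_)
  · have hleft : (-(r * e) + (1 - e)) * ((u - 1) * e + (1 - e)) = 1 := by
      have h1 : r * (u - 1) = -e := by rw [hre]; noncomm_ring
      have h2 : r * e * ((u - 1) * e) = -e := by
        rw [mul_assoc, ← mul_assoc e, hcomm (u - 1), mul_assoc, he.eq, ← mul_assoc, h1, neg_mul,
          he.eq]
      have h3 : r * e * (1 - e) = 0 := by rw [mul_assoc, hee', mul_zero]
      have h4 : (1 - e) * ((u - 1) * e) = 0 := by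
        rw [← hcomm, ← mul_assoc, sub_mul, he.eq, one_mul, sub_self, zero_mul]
      rw [add_mul, mul_add, mul_add, neg_mul, neg_mul, h2, h3, h4, he.one_sub.eq]
      abel
    -- a left inverse is an inverse: `q * p` is a central idempotent when `p * q = 1`
    generalize -(r * e) + (1 - e) = p at hleft
    generalize (u - 1) * e + (1 - e) = q at hleft
    have hid : IsIdempotentElem (q * p) := by
      unfold IsIdempotentElem
      rw [mul_assoc, ← mul_assoc p, hleft, one_mul]
    refine isUnit_iff_exists.2 ⟨p, ?_, hleft⟩
    have h1 := hc.mul_comm_of_isIdempotentElem hJ h hid p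
    calc q * p = p * q * (q * p) := by rw [hleft, one_mul]
      _ = p * (q * p * q) := by rw [mul_assoc, hc.mul_comm_of_isIdempotentElem hJ h hid]
      _ = 1 := by rw [mul_assoc q, hleft, mul_one, hleft]
  · obtain ⟨v, hv, hv'⟩ := isUnit_iff_exists.1 hu
    have heq : e + ((u - 1) * e + (1 - e)) = u * e + (1 - e) := by
      rw [sub_mul, one_mul]; abel
    rw [heq]
    have key : ∀ a b : Q, a * b = 1 → (a * e + (1 - e)) * (b * e + (1 - e)) = 1 := by
      intro a b hab
      have h2 : a * e * (b * e) = e := by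
        rw [mul_assoc, ← mul_assoc e, hcomm b, mul_assoc, he.eq, ← mul_assoc, hab, one_mul]
      have h3 : a * e * (1 - e) = 0 := by rw [mul_assoc, hee', mul_zero]
      have h4 : (1 - e) * (b * e) = 0 := by
        rw [← hcomm, ← mul_assoc, sub_mul, he.eq, one_mul, sub_self, zero_mul]
      rw [add_mul, mul_add, mul_add, h2, h3, h4, he.one_sub.eq]
      abel
    exact isUnit_iff_exists.2 ⟨_, key _ _ hv, key _ _ hv'⟩

end NoSumOfUnits

section Semiboolean

variable {R : Type*} [Ring R]

theorem IsSemiboolean.mul_self_sub_mem (h : IsSemiboolean R) (a : R) :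
    a * a - a ∈ Ring.jacobson R := by
  obtain ⟨e, he, hae⟩ := h a
  have : a * a - a = a * (a - e) + (a - e) * e - (a - e) := by
    simp only [mul_sub, sub_mul, he.eq]; abel
  rw [this]
  exact sub_mem (add_mem (Ideal.mul_mem_left _ _ hae) (Ideal.mul_mem_right _ _ hae)) hae

theorem IsUnitUC.isSemiboolean (h : IsUnitUC R) : IsSemiboolean R := by
  have h0 : ∀ f v : R, IsIdempotentElem f → IsUnit v → IsUnit (f + v) → f = 0 := by
    intro f v hf hv hfv
    obtain ⟨w, hw⟩ := h.unique f 0 v (f + v) hf IsIdempotentElem.zero hv hfv (zero_add _).symm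
    simpa using hw
  -- both cleanness and the previous property descend to the quotient `R / J(R)`
  have hcQ : IsCleanRing (R ⧸ Ring.jacobson R) := by
    intro a
    obtain ⟨a, rfl⟩ := Ideal.Quotient.mk_surjective a
    obtain ⟨e, u, he, hu, rfl⟩ := h.clean a
    exact ⟨_, _, he.map (Ideal.Quotient.mk _), hu.map (Ideal.Quotient.mk _), map_add _ _ _⟩
  have hQ : ∀ f v : R ⧸ Ring.jacobson R,
      IsIdempotentElem f → IsUnit v → IsUnit (f + v) → f = 0 := by
    intro f v hf hv hfv
    obtain ⟨f, rfl⟩ := Ideal.Quotient.mk_surjective f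
    obtain ⟨v, rfl⟩ := Ideal.Quotient.mk_surjective v
    obtain ⟨-, -, g, -, -, -, hg, -, c, hc⟩ := h.clean.exists_isIdempotentElem_sub_eq f
    have hfg : Ideal.Quotient.mk (Ring.jacobson R) f = Ideal.Quotient.mk _ g := by
      rw [← sub_eq_zero, ← map_sub, hc, map_mul, map_sub, map_mul, hf.eq, sub_self, mul_zero]
    rw [hfg] at hfv ⊢
    rw [← map_add] at hfv
    rw [h0 g v hg (isUnit_of_isUnit_mk_ringJacobson hv) (isUnit_of_isUnit_mk_ringJacobson hfv),
      map_zero]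
  intro a
  obtain ⟨-, -, g, -, -, -, hg, -, c, hc⟩ := h.clean.exists_isIdempotentElem_sub_eq a
  refine ⟨g, hg, ?_⟩
  rw [hc]
  refine Ideal.mul_mem_left _ _ ?_
  -- in `R / J(R)` the only unit is `1`, so `a - 1` is idempotent, and so is every element
  obtain ⟨e, u, he, hu, hau⟩ := hcQ (Ideal.Quotient.mk _ (a + 1))
  rw [hcQ.eq_one_of_isUnit (Ring.jacobson_quotient_jacobson R) hQ hu, map_add, map_one,
    add_left_inj] at hau
  rw [← Ideal.Quotient.eq_zero_iff_mem, map_sub, map_mul, hau, he.eq, sub_self]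

theorem IsSemiboolean.sub_one_mem_of_isUnit (h : IsSemiboolean R) {u : R} (hu : IsUnit u) :
    u - 1 ∈ Ring.jacobson R := by
  obtain ⟨v, hv⟩ := hu.exists_left_inv
  have : u - 1 = v * (u * u - u) := by rw [mul_sub, ← mul_assoc, hv, one_mul]
  rw [this]
  exact Ideal.mul_mem_left _ _ (h.mul_self_sub_mem u)

theorem IsSemiboolean.isUnitUC (h : IsSemiboolean R) : IsUnitUC R where
  clean a := by
    obtain ⟨e, he, hae⟩ := h (a - 1)
    refine ⟨e, a - e, he, isUnit_of_sub_mem_ringJacobson isUnit_one ?_, by abel⟩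
    rwa [sub_right_comm]
  unique e f u v he hf hu hv huv := by
    refine unitEquiv_of_sub_mem_ringJacobson he hf ?_
    have : e - f = (v - 1) - (u - 1) := by
      rw [sub_sub_sub_cancel_right, sub_eq_sub_iff_add_eq_add, huv, add_comm]
    rw [this]
    exact sub_mem (h.sub_one_mem_of_isUnit hv) (h.sub_one_mem_of_isUnit hu)

/-- The structure theorem behind all the others: unit unique cleanness says that `R / J(R)` is
Boolean and that idempotents lift modulo `J(R)`. -/
theorem isUnitUC_iff_isSemiboolean : IsUnitUC R ↔ IsSemiboolean R :=
  ⟨IsUnitUC.isSemiboolean, IsSemiboolean.isUnitUC⟩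

theorem IsSemiboolean.of_surjective {S : Type*} [Ring S] (h : IsSemiboolean R) (f : R →+* S)
    (hf : Function.Surjective f) : IsSemiboolean S := by
  intro a
  obtain ⟨a, rfl⟩ := hf a
  obtain ⟨e, he, hae⟩ := h a
  exact ⟨f e, he.map f, by rw [← map_sub]; exact map_mem_ringJacobson hf hae⟩

theorem RingEquiv.isSemiboolean_iff {S : Type*} [Ring S] (f : R ≃+* S) :
    IsSemiboolean R ↔ IsSemiboolean S :=
  ⟨fun h => h.of_surjective f.toRingHom f.surjective,
    fun h => h.of_surjective f.symm.toRingHom f.symm.surjective⟩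

/-- Semibooleanness passes both ways along a split surjection whose kernel lies in the Jacobson
radical. -/
theorem isSemiboolean_iff_of_split {S : Type*} [Ring S] (f : R →+* S) (g : S →+* R)
    (hfg : ∀ s, f (g s) = s) (hker : ∀ x, f x = 0 → x ∈ Ring.jacobson R) :
    IsSemiboolean R ↔ IsSemiboolean S := by
  have hf : Function.Surjective f := fun s => ⟨g s, hfg s⟩
  refine ⟨fun h => h.of_surjective f hf, fun h a => ?_⟩
  obtain ⟨e, he, hae⟩ := h (f a)
  refine ⟨g e, he.map g, (map_mem_ringJacobson_iff hf hker).1 ?_⟩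
  rwa [map_sub, hfg]

theorem isSemiboolean_pi {ι : Type*} {S : ι → Type*} [∀ i, Ring (S i)]
    (h : ∀ i, IsSemiboolean (S i)) : IsSemiboolean (∀ i, S i) := by
  intro a
  choose e he hae using fun i => h i (a i)
  refine ⟨e, funext he, mem_ringJacobson_iff_exists_mul_eq_one.2 fun y => ?_⟩
  choose z hz using fun i => mem_ringJacobson_iff_exists_mul_eq_one.1 (hae i) (y i)
  exact ⟨z, funext hz⟩

theorem isSemiboolean_prod_iff {S : Type*} [Ring S] :
    IsSemiboolean (R × S) ↔ IsSemiboolean R ∧ IsSemiboolean S := by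
  refine ⟨fun h => ⟨h.of_surjective (RingHom.fst R S) Prod.fst_surjective,
    h.of_surjective (RingHom.snd R S) Prod.snd_surjective⟩, fun ⟨hR, hS⟩ ⟨a, b⟩ => ?_⟩
  obtain ⟨e, he, hae⟩ := hR a
  obtain ⟨f, hf, hbf⟩ := hS b
  refine ⟨(e, f), Prod.ext he hf, mem_ringJacobson_iff_exists_mul_eq_one.2 fun ⟨y, y'⟩ => ?_⟩
  obtain ⟨z, hz⟩ := mem_ringJacobson_iff_exists_mul_eq_one.1 hae y
  obtain ⟨z', hz'⟩ := mem_ringJacobson_iff_exists_mul_eq_one.1 hbf y'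
  exact ⟨(z, z'), Prod.ext hz hz'⟩

end Semiboolean

/-! ### Corner rings and the Peirce decomposition -/

section Corner

variable {R : Type*} [Ring R] {e : R} (he : IsIdempotentElem e)

theorem IsIdempotentElem.mul_coe_corner (x : he.Corner) : e * x.1 = x.1 :=
  ((Subsemigroup.mem_corner_iff he).1 x.2).1

theorem IsIdempotentElem.coe_corner_mul (x : he.Corner) : x.1 * e = x.1 :=
  ((Subsemigroup.mem_corner_iff he).1 x.2).2

/-- The radical of a corner: `J(eRe) = J(R) ∩ eRe`. -/
theorem IsIdempotentElem.mem_ringJacobson_corner_iff {x : he.Corner} :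
    x ∈ Ring.jacobson he.Corner ↔ x.1 ∈ Ring.jacobson R := by
  have hex := he.mul_coe_corner x
  have hxe := he.coe_corner_mul x
  constructor
  · intro hx
    refine mem_ringJacobson_iff_exists_mul_eq_one.2 fun y => ?_
    -- with `z = (e + x y e)⁻¹` in `eRe`, the inverse of `1 + y x` is `1 - y z x`
    let y' : he.Corner := ⟨e * y * e, y, rfl⟩
    obtain ⟨z, hz⟩ := (isUnit_one_add_of_mem_ringJacobson
      (Ideal.mul_mem_right y' _ hx)).exists_left_inv
    have hz : z.1 * (e + x.1 * (e * y * e)) = e := congrArg Subtype.val hz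
    have h1 : z.1 * x.1 + z.1 * x.1 * y * x.1 = x.1 := by
      calc z.1 * x.1 + z.1 * x.1 * y * x.1
          = z.1 * (e * x.1) + z.1 * ((x.1 * e) * y * (e * x.1)) := by
            rw [hex, hxe]; simp only [mul_assoc]
        _ = z.1 * (e + x.1 * (e * y * e)) * x.1 := by
            simp only [mul_add, add_mul, mul_assoc]
        _ = x.1 := by rw [hz, hex]
    refine ⟨1 - y * z.1 * x.1, ?_⟩
    calc (1 - y * z.1 * x.1) * (1 + y * x.1)
        = 1 + y * x.1 - y * (z.1 * x.1 + z.1 * x.1 * y * x.1) := by noncomm_ring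
      _ = 1 := by rw [h1, add_sub_cancel_right]
  · intro hx
    refine mem_ringJacobson_iff_exists_mul_eq_one.2 fun y => ?_
    obtain ⟨z, hz⟩ := mem_ringJacobson_iff_exists_mul_eq_one.1 hx y.1
    refine ⟨⟨e * z * e, z, rfl⟩, Subtype.ext ?_⟩
    change e * z * e * (e + y.1 * x.1) = e
    calc e * z * e * (e + y.1 * x.1) = e * z * (e * e + (e * y.1) * x.1) := by
          simp only [mul_add, mul_assoc]
      _ = e * (z * (1 + y.1 * x.1)) * e := by
          rw [he.eq, he.mul_coe_corner]
          simp only [mul_add, add_mul, mul_assoc, hxe, mul_one]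
      _ = e := by rw [hz, mul_one, he.eq]

/-- Idempotents of a semiboolean ring lift into the left ideal generated by the given element. -/
theorem IsSemiboolean.exists_isIdempotentElem_mul (h : IsSemiboolean R) (a : R) :
    ∃ c, IsIdempotentElem (c * a) ∧ a - c * a ∈ Ring.jacobson R := by
  obtain ⟨-, -, g, -, -, -, hg, -, c, hc⟩ := h.isUnitUC.clean.exists_isIdempotentElem_sub_eq a
  have hga : (1 - c * (a - 1)) * a = g := by
    rw [← sub_sub_cancel a g, hc]; noncomm_ring
  refine ⟨1 - c * (a - 1), by rwa [hga], ?_⟩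
  rw [hga, hc]
  exact Ideal.mul_mem_left _ _ (h.mul_self_sub_mem a)

theorem IsSemiboolean.corner (h : IsSemiboolean R) : IsSemiboolean he.Corner := by
  intro a
  have hea := he.mul_coe_corner a
  have hae := he.coe_corner_mul a
  obtain ⟨c, hc, hac⟩ := h.exists_isIdempotentElem_mul a.1
  have hee : e * (c * a.1) * e = e * (c * a.1) := by simp only [mul_assoc, hae]
  refine ⟨⟨e * (c * a.1) * e, _, rfl⟩, Subtype.ext ?_, he.mem_ringJacobson_corner_iff.2 ?_⟩
  · change e * (c * a.1) * e * (e * (c * a.1) * e) = e * (c * a.1) * e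
    rw [hee]
    calc e * (c * a.1) * (e * (c * a.1)) = e * ((c * (a.1 * e)) * (c * a.1)) := by
          simp only [mul_assoc]
      _ = e * (c * a.1) := by rw [hae, hc.eq]
  · change a.1 - e * (c * a.1) * e ∈ _
    rw [hee]
    have := Ideal.mul_mem_left _ e hac
    rwa [mul_sub, hea] at this

/-- Semibooleanness in terms of the Peirce decomposition of the ring. -/
theorem IsIdempotentElem.isSemiboolean_iff_corner :
    IsSemiboolean R ↔
      IsSemiboolean he.Corner ∧ IsSemiboolean he.one_sub.Corner ∧
        (∀ r : R, e * r * (1 - e) ∈ Ring.jacobson R) ∧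
        (∀ r : R, (1 - e) * r * e ∈ Ring.jacobson R) := by
  have hef : e * (1 - e) = 0 := by rw [mul_sub, he.eq, mul_one, sub_self]
  have hfe : (1 - e) * e = 0 := by rw [sub_mul, he.eq, one_mul, sub_self]
  constructor
  · intro h
    -- the off-diagonal parts have square zero
    refine ⟨h.corner he, h.corner he.one_sub, fun r => ?_, fun r => ?_⟩
    · have h0 : e * r * (1 - e) * (e * r * (1 - e)) = 0 := by
        calc _ = e * r * ((1 - e) * e) * r * (1 - e) := by simp only [mul_assoc]
          _ = 0 := by simp [hfe]
      have := h.mul_self_sub_mem (e * r * (1 - e))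
      rwa [h0, zero_sub, neg_mem_iff] at this
    · have h0 : (1 - e) * r * e * ((1 - e) * r * e) = 0 := by
        calc _ = (1 - e) * r * (e * (1 - e)) * r * e := by simp only [mul_assoc]
          _ = 0 := by simp [hef]
      have := h.mul_self_sub_mem ((1 - e) * r * e)
      rwa [h0, zero_sub, neg_mem_iff] at this
  · rintro ⟨h1, h2, h3, h4⟩ a
    obtain ⟨p, hp, hap⟩ := h1 ⟨e * a * e, a, rfl⟩
    obtain ⟨q, hq, haq⟩ := h2 ⟨(1 - e) * a * (1 - e), a, rfl⟩
    have hap : e * a * e - p.1 ∈ Ring.jacobson R := he.mem_ringJacobson_corner_iff.1 hap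
    have haq : (1 - e) * a * (1 - e) - q.1 ∈ Ring.jacobson R :=
      he.one_sub.mem_ringJacobson_corner_iff.1 haq
    have hp : p.1 * p.1 = p.1 := congrArg Subtype.val hp
    have hq : q.1 * q.1 = q.1 := congrArg Subtype.val hq
    have hpq : p.1 * q.1 = 0 := by
      rw [← he.coe_corner_mul p, ← he.one_sub.mul_coe_corner q, mul_assoc, ← mul_assoc e, hef,
        zero_mul, mul_zero]
    have hqp : q.1 * p.1 = 0 := by
      rw [← he.one_sub.coe_corner_mul q, ← he.mul_coe_corner p, mul_assoc, ← mul_assoc (1 - e), hfe,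
        zero_mul, mul_zero]
    refine ⟨p.1 + q.1, ?_, ?_⟩
    · simp only [IsIdempotentElem, mul_add, add_mul, hp, hq, hpq, hqp]
      abel
    · have : a - (p.1 + q.1) = (e * a * e - p.1) + ((1 - e) * a * (1 - e) - q.1) +
          e * a * (1 - e) + (1 - e) * a * e := by
        noncomm_ring
      rw [this]
      exact add_mem (add_mem (add_mem hap haq) (h3 a)) (h4 a)

end Corner

/-! ### Morita context rings -/

namespace MoritaContext

variable {A B M N : Type*} [Ring A] [Ring B] [AddCommGroup M] [AddCommGroup N]
  [Module A M] [Module Bᵐᵒᵖ M] [SMulCommClass A Bᵐᵒᵖ M]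
  [Module B N] [Module Aᵐᵒᵖ N] [SMulCommClass B Aᵐᵒᵖ N]

namespace MatrixRing

variable {C : MoritaContext A B M N}

@[simp] theorem sub_a (x y : MatrixRing C) : (x - y).a = x.a - y.a := by
  simp [sub_eq_add_neg]
@[simp] theorem sub_m (x y : MatrixRing C) : (x - y).m = x.m - y.m := by
  simp [sub_eq_add_neg]
@[simp] theorem sub_n (x y : MatrixRing C) : (x - y).n = x.n - y.n := by
  simp [sub_eq_add_neg]
@[simp] theorem sub_b (x y : MatrixRing C) : (x - y).b = x.b - y.b := by
  simp [sub_eq_add_neg]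

variable (C) in
/-- The idempotent with rows `(1, 0)` and `(0, 0)`. -/
def e₁₁ : MatrixRing C := ⟨1, 0, 0, 0⟩

@[simp] theorem e₁₁_a : (e₁₁ C).a = 1 := rfl
@[simp] theorem e₁₁_m : (e₁₁ C).m = 0 := rfl
@[simp] theorem e₁₁_n : (e₁₁ C).n = 0 := rfl
@[simp] theorem e₁₁_b : (e₁₁ C).b = 0 := rfl

theorem isIdempotentElem_e₁₁ : IsIdempotentElem (e₁₁ C) := by
  ext <;> simp

theorem e₁₁_mul_mul_one_sub (r : MatrixRing C) : e₁₁ C * r * (1 - e₁₁ C) = ⟨0, r.m, 0, 0⟩ := by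
  ext <;> simp

theorem one_sub_mul_mul_e₁₁ (r : MatrixRing C) : (1 - e₁₁ C) * r * e₁₁ C = ⟨0, 0, r.n, 0⟩ := by
  ext <;> simp

variable (C) in
/-- The corner of `e₁₁` is the first diagonal ring. -/
def equivCorner : A ≃+* (isIdempotentElem_e₁₁ (C := C)).Corner where
  toFun a := ⟨⟨a, 0, 0, 0⟩, ⟨a, 0, 0, 0⟩, by ext <;> simp⟩
  invFun x := x.1.a
  left_inv _ := rfl
  right_inv := by
    rintro ⟨_, x, rfl⟩
    apply Subtype.ext
    ext <;> simp
  map_mul' a b := Subtype.ext <| by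
    change (_ : MatrixRing C) = _ * _
    ext <;> simp
  map_add' a b := Subtype.ext <| by
    change (_ : MatrixRing C) = _ + _
    ext <;> simp

variable (C) in
/-- The corner of `1 - e₁₁` is the second diagonal ring. -/
def equivCornerOneSub : B ≃+* (isIdempotentElem_e₁₁ (C := C)).one_sub.Corner where
  toFun b := ⟨⟨0, 0, 0, b⟩, ⟨0, 0, 0, b⟩, by ext <;> simp⟩
  invFun x := x.1.b
  left_inv _ := rfl
  right_inv := by
    rintro ⟨_, x, rfl⟩
    apply Subtype.ext
    ext <;> simp
  map_mul' a b := Subtype.ext <| by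
    change (_ : MatrixRing C) = _ * _
    ext <;> simp
  map_add' a b := Subtype.ext <| by
    change (_ : MatrixRing C) = _ + _
    ext <;> simp

theorem mem_ringJacobson_of_mk_a {a : A}
    (h : (⟨a, 0, 0, 0⟩ : MatrixRing C) ∈ Ring.jacobson (MatrixRing C)) : a ∈ Ring.jacobson A :=
  map_mem_ringJacobson (f := (equivCorner C).symm.toRingHom) (equivCorner C).symm.surjective
    ((isIdempotentElem_e₁₁ (C := C)).mem_ringJacobson_corner_iff (x := equivCorner C a) |>.2 h)

theorem mem_ringJacobson_of_mk_b {b : B}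
    (h : (⟨0, 0, 0, b⟩ : MatrixRing C) ∈ Ring.jacobson (MatrixRing C)) : b ∈ Ring.jacobson B :=
  map_mem_ringJacobson (f := (equivCornerOneSub C).symm.toRingHom)
    (equivCornerOneSub C).symm.surjective
    ((isIdempotentElem_e₁₁ (C := C)).one_sub.mem_ringJacobson_corner_iff
      (x := equivCornerOneSub C b) |>.2 h)

/-- An entry `m` with `Nm ⊆ J(B)` lies in the radical: membership in the radical is tested on
left multiples only, so `mN` does not enter. -/
theorem mk_m_mem_ringJacobson {m : M} (h : ∀ n, C.ψ n m ∈ Ring.jacobson B) :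
    (⟨0, m, 0, 0⟩ : MatrixRing C) ∈ Ring.jacobson (MatrixRing C) := by
  refine mem_ringJacobson_iff_exists_mul_eq_one.2 fun y => ?_
  obtain ⟨z, hz⟩ := (isUnit_one_add_of_mem_ringJacobson (h y.n)).exists_left_inv
  -- `1 + y * x` has rows `(1, y.a • m)` and `(0, 1 + ψ y.n m)`
  refine ⟨⟨1, -(y.a • m) <• z, 0, z⟩, ?_⟩
  ext
  · simp
  · simp only [mul_m, add_m, add_b, one_m, one_b, mul_b, zero_add, mul_zero,
      add_zero, smul_smul, MulOpposite.op_zero, zero_smul, ← MulOpposite.op_mul]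
    rw [hz]
    simp
  · simp
  · simp [hz]

theorem mk_n_mem_ringJacobson {n : N} (h : ∀ m, C.φ m n ∈ Ring.jacobson A) :
    (⟨0, 0, n, 0⟩ : MatrixRing C) ∈ Ring.jacobson (MatrixRing C) := by
  refine mem_ringJacobson_iff_exists_mul_eq_one.2 fun y => ?_
  obtain ⟨z, hz⟩ := (isUnit_one_add_of_mem_ringJacobson (h y.m)).exists_left_inv
  -- `1 + y * x` has rows `(1 + φ y.m n, 0)` and `(y.b • n, 1)`
  refine ⟨⟨z, 0, -(y.b • n) <• z, 1⟩, ?_⟩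
  ext
  · simp [hz]
  · simp
  · simp only [mul_n, add_n, add_a, one_n, one_a, mul_a, zero_add, mul_zero,
      smul_smul, MulOpposite.op_zero, zero_smul, ← MulOpposite.op_mul]
    rw [hz]
    simp
  · simp

theorem isSemiboolean_iff :
    IsSemiboolean (MatrixRing C) ↔ IsSemiboolean A ∧ IsSemiboolean B ∧
      (∀ m n, C.φ m n ∈ Ring.jacobson A) ∧ (∀ n m, C.ψ n m ∈ Ring.jacobson B) := by
  rw [(isIdempotentElem_e₁₁ (C := C)).isSemiboolean_iff_corner,
    ← (equivCorner C).isSemiboolean_iff, ← (equivCornerOneSub C).isSemiboolean_iff]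
  refine and_congr_right fun _ => and_congr_right fun _ => ?_
  simp only [e₁₁_mul_mul_one_sub, one_sub_mul_mul_e₁₁]
  constructor
  · rintro ⟨hm, -⟩
    refine ⟨fun m n => mem_ringJacobson_of_mk_a (C := C) ?_,
      fun n m => mem_ringJacobson_of_mk_b (C := C) ?_⟩
    · have h : (⟨C.φ m n, 0, 0, 0⟩ : MatrixRing C) = ⟨0, m, 0, 0⟩ * ⟨0, 0, n, 0⟩ := by
        ext <;> simp
      rw [h]
      exact Ideal.mul_mem_right _ _ (hm ⟨0, m, 0, 0⟩)
    · have h : (⟨0, 0, 0, C.ψ n m⟩ : MatrixRing C) = ⟨0, 0, n, 0⟩ * ⟨0, m, 0, 0⟩ := by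
        ext <;> simp
      rw [h]
      exact Ideal.mul_mem_left _ _ (hm ⟨0, m, 0, 0⟩)
  · rintro ⟨hφ, hψ⟩
    exact ⟨fun r => mk_m_mem_ringJacobson fun n => hψ n r.m,
      fun r => mk_n_mem_ringJacobson fun m => hφ m r.n⟩

end MatrixRing

theorem traceMN_subset_iff (C : MoritaContext A B M N) {I : Ideal A} :
    (C.traceMN : Set A) ⊆ I ↔ ∀ m n, C.φ m n ∈ I := by
  change C.traceMN ≤ I.toAddSubgroup ↔ _
  rw [traceMN, AddSubgroup.closure_le]
  exact ⟨fun h m n => h ⟨m, n, rfl⟩, by rintro h _ ⟨m, n, rfl⟩; exact h m n⟩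

theorem traceNM_subset_iff (C : MoritaContext A B M N) {I : Ideal B} :
    (C.traceNM : Set B) ⊆ I ↔ ∀ n m, C.ψ n m ∈ I := by
  change C.traceNM ≤ I.toAddSubgroup ↔ _
  rw [traceNM, AddSubgroup.closure_le]
  exact ⟨fun h n m => h ⟨n, m, rfl⟩, by rintro h _ ⟨n, m, rfl⟩; exact h n m⟩

theorem isUnitUC_matrixRing_iff (C : MoritaContext A B M N) :
    IsUnitUC C.MatrixRing ↔ IsUnitUC A ∧ IsUnitUC B ∧
      (C.traceMN : Set A) ⊆ Ring.jacobson A ∧ (C.traceNM : Set B) ⊆ Ring.jacobson B := by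
  simp only [isUnitUC_iff_isSemiboolean, traceMN_subset_iff, traceNM_subset_iff,
    MatrixRing.isSemiboolean_iff]

end MoritaContext

/-! ### Triangular matrix rings -/

namespace FormalTriangular

variable {R S M : Type*} [Ring R] [Ring S] [AddCommGroup M]
  [Module R M] [Module Sᵐᵒᵖ M] [SMulCommClass R Sᵐᵒᵖ M]

variable (R S M) in
/-- The diagonal of a formal triangular matrix. -/
def diagHom : FormalTriangular R S M →+* R × S where
  toFun x := (x.r, x.s)
  map_zero' := rfl
  map_one' := rfl
  map_add' _ _ := rfl
  map_mul' _ _ := rfl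

variable (R S M) in
/-- Diagonal matrices as formal triangular matrices. -/
def ofDiagHom : R × S →+* FormalTriangular R S M where
  toFun x := ⟨x.1, 0, x.2⟩
  map_zero' := rfl
  map_one' := rfl
  map_add' _ _ := by ext <;> simp
  map_mul' _ _ := by ext <;> simp

theorem isUnitUC_iff : IsUnitUC (FormalTriangular R S M) ↔ IsUnitUC R ∧ IsUnitUC S := by
  simp only [isUnitUC_iff_isSemiboolean]
  rw [← isSemiboolean_prod_iff]
  refine isSemiboolean_iff_of_split (diagHom R S M) (ofDiagHom R S M) (fun _ => rfl) ?_
  intro x hx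
  have hr : x.r = 0 := congrArg Prod.fst hx
  have hs : x.s = 0 := congrArg Prod.snd hx
  refine mem_ringJacobson_iff_exists_mul_eq_one.2 fun y => ⟨⟨1, -(y.r • x.m), 1⟩, ?_⟩
  ext <;> simp [hr, hs]

end FormalTriangular

namespace Matrix

/-- The `k`-th power of a strictly upper triangular matrix vanishes below the `k`-th
superdiagonal. -/
theorem pow_apply_eq_zero_of_strictly_upper {K : Type*} [Ring K] {n : ℕ}
    {X : Matrix (Fin n) (Fin n) K} (hX : ∀ i j, j ≤ i → X i j = 0) (k : ℕ) (i j : Fin n)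
    (hij : (j : ℕ) < i + k) : (X ^ k) i j = 0 := by
  induction k generalizing j with
  | zero => exact Matrix.one_apply_ne (by rintro rfl; simp at hij)
  | succ k ih =>
    rw [pow_succ, Matrix.mul_apply]
    refine Finset.sum_eq_zero fun l _ => ?_
    rcases lt_or_ge (l : ℕ) (i + k) with hl | hl
    · rw [ih l hl, zero_mul]
    · rw [hX l j (Fin.le_def.2 (by omega)), mul_zero]

theorem isNilpotent_of_strictly_upper {K : Type*} [Ring K] {n : ℕ}
    {X : Matrix (Fin n) (Fin n) K} (hX : ∀ i j, j ≤ i → X i j = 0) : IsNilpotent X :=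
  ⟨n, by ext i j; exact pow_apply_eq_zero_of_strictly_upper hX n i j (by omega)⟩

end Matrix

section UpperTriangular

variable (K : Type*) [Ring K] (n : ℕ)

theorem upperTriangularSubring_mul_diag (X Y : upperTriangularSubring K n) (i : Fin n) :
    (X * Y).1 i i = X.1 i i * Y.1 i i := by
  change (X.1 * Y.1) i i = _
  rw [Matrix.mul_apply, Finset.sum_eq_single i]
  · intro j _ hj
    rcases lt_or_gt_of_ne hj with h | h
    · rw [X.2 h, zero_mul]
    · rw [Y.2 h, mul_zero]
  · simp

/-- The diagonal of an upper triangular matrix. -/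
def upperTriangularDiagHom : upperTriangularSubring K n →+* (Fin n → K) where
  toFun X i := X.1 i i
  map_zero' := rfl
  map_one' := funext fun i => Matrix.one_apply_eq i
  map_add' _ _ := rfl
  map_mul' X Y := funext fun i => upperTriangularSubring_mul_diag K n X Y i

theorem isUnitUC_upperTriangularSubring_iff (hn : 1 ≤ n) :
    IsUnitUC (upperTriangularSubring K n) ↔ IsUnitUC K := by
  simp only [isUnitUC_iff_isSemiboolean]
  have hpi : IsSemiboolean (Fin n → K) ↔ IsSemiboolean K :=
    ⟨fun h => h.of_surjective (Pi.evalRingHom _ ⟨0, hn⟩) (Function.surjective_eval _),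
      fun h => isSemiboolean_pi fun _ => h⟩
  rw [← hpi]
  refine isSemiboolean_iff_of_split (upperTriangularDiagHom K n)
    ((Matrix.diagonalRingHom (Fin n) K).codRestrict (upperTriangularSubring K n)
      fun d => Matrix.blockTriangular_diagonal d)
    (fun d => funext fun i => Matrix.diagonal_apply_eq d i) fun X hX => ?_
  refine mem_ringJacobson_iff_isUnit.2 fun Y => IsNilpotent.isUnit_one_add ?_
  have hnil : IsNilpotent (Y * X).1 := by
    refine Matrix.isNilpotent_of_strictly_upper fun i j hij => ?_
    rcases hij.lt_or_eq with h | rfl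
    · exact (Y * X).2 h
    · rw [upperTriangularSubring_mul_diag, show X.1 j j = 0 from congrFun hX j, mul_zero]
  obtain ⟨k, hk⟩ := hnil
  exact ⟨k, Subtype.ext hk⟩

end UpperTriangular

/-! ### The rings `K_s(R)` -/

namespace KRing

variable {R : Type*} [Ring R]

/-- The Morita context with all four entries `R` whose two pairings are `(x, y) ↦ s * x * y`. -/
def moritaContext (s : Subring.center R) : MoritaContext R R R R where
  φ := (AddMonoidHom.mul (R := R)).comp (AddMonoidHom.mulLeft (s : R))
  ψ := (AddMonoidHom.mul (R := R)).comp (AddMonoidHom.mulLeft (s : R))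
  φ_balanced m b n := by simp [mul_assoc]
  φ_left a m n := by simp [mul_assoc, left_comm]
  φ_right m n a := by simp [mul_assoc]
  ψ_balanced n a m := by simp [mul_assoc]
  ψ_left b n m := by simp [mul_assoc, left_comm]
  ψ_right n m b := by simp [mul_assoc]
  assoc_M m n m' := by simp [mul_assoc, left_comm]
  assoc_N n m n' := by simp [mul_assoc, left_comm]

/-- `K_s(R)` is a Morita context ring. -/
def equivMatrixRing (s : Subring.center R) : KRing R s ≃+* (moritaContext s).MatrixRing where
  toFun p := ⟨p.a, p.x, p.y, p.b⟩
  invFun p := ⟨p.a, p.m, p.n, p.b⟩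
  left_inv _ := rfl
  right_inv _ := rfl
  map_mul' _ _ := rfl
  map_add' _ _ := rfl

theorem isUnitUC_iff (s : Subring.center R) :
    IsUnitUC (KRing R s) ↔ IsUnitUC R ∧ (s : R) ∈ Ring.jacobson R := by
  simp only [isUnitUC_iff_isSemiboolean]
  rw [(equivMatrixRing s).isSemiboolean_iff, MoritaContext.MatrixRing.isSemiboolean_iff]
  have key : (∀ m n, (moritaContext s).φ m n ∈ Ring.jacobson R) ↔ (s : R) ∈ Ring.jacobson R := by
    change (∀ m n : R, (s : R) * m * n ∈ Ring.jacobson R) ↔ _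
    refine ⟨fun h => by simpa using h 1 1, fun h m n => ?_⟩
    exact Ideal.mul_mem_right _ _ (Ideal.mul_mem_right _ _ h)
  have key' : (∀ n m, (moritaContext s).ψ n m ∈ Ring.jacobson R) ↔ (s : R) ∈ Ring.jacobson R := key
  rw [key, key']
  tauto

/-- When `R` is unit uniquely clean, `R / J(R)` is Boolean, so that `2 = 2 * 2 - 2 ∈ J(R)`. -/
theorem isUnitUC_two_iff : IsUnitUC (KRing R 2) ↔ IsUnitUC R := by
  rw [isUnitUC_iff, and_iff_left_of_imp]
  intro h
  have h2 := h.isSemiboolean.mul_self_sub_mem 2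
  have : (2 : R) * 2 - 2 = 2 := by norm_num
  rwa [this] at h2

end KRing

theorem mainTheorem6 :
    -- the Morita context ring
    (∀ (A : Type*) (B : Type*) (M : Type*) (N : Type*) [Ring A] [Ring B]
        [AddCommGroup M] [AddCommGroup N]
        [Module A M] [Module Bᵐᵒᵖ M] [SMulCommClass A Bᵐᵒᵖ M]
        [Module B N] [Module Aᵐᵒᵖ N] [SMulCommClass B Aᵐᵒᵖ N]
        (C : MoritaContext A B M N),
      IsUnitUC C.MatrixRing ↔
        IsUnitUC A ∧ IsUnitUC B ∧
          (C.traceMN : Set A) ⊆ Ring.jacobson A ∧ (C.traceNM : Set B) ⊆ Ring.jacobson B) ∧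
    -- the Peirce decomposition
    (∀ (R : Type*) [Ring R] (e : R) (he : IsIdempotentElem e),
      IsUnitUC R ↔
        IsUnitUC he.Corner ∧ IsUnitUC he.one_sub.Corner ∧
          (∀ r : R, e * r * (1 - e) ∈ Ring.jacobson R) ∧
          (∀ r : R, (1 - e) * r * e ∈ Ring.jacobson R)) ∧
    -- formal triangular matrix rings
    (∀ (R : Type*) (S : Type*) (M : Type*) [Ring R] [Ring S] [AddCommGroup M]
        [Module R M] [Module Sᵐᵒᵖ M] [SMulCommClass R Sᵐᵒᵖ M],
      IsUnitUC (FormalTriangular R S M) ↔ IsUnitUC R ∧ IsUnitUC S) ∧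
    -- upper triangular matrix rings
    (∀ (K : Type*) [Ring K] (n : ℕ), 1 ≤ n →
      (IsUnitUC (upperTriangularSubring K n) ↔ IsUnitUC K)) ∧
    -- the rings `K_s(R)`
    (∀ (R : Type*) [Ring R] (s : Subring.center R),
      IsUnitUC (KRing R s) ↔ IsUnitUC R ∧ (s : R) ∈ Ring.jacobson R) ∧
    -- the ring `K_2(R)`
    (∀ (R : Type*) [Ring R], IsUnitUC (KRing R 2) ↔ IsUnitUC R) := by
  refine ⟨fun A B M N => ?_, fun R _ e he => ?_, fun R S M => ?_, fun K _ n hn => ?_,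
    fun R _ s => ?_, fun R _ => ?_⟩
  · intros
    exact MoritaContext.isUnitUC_matrixRing_iff _
  · simp only [isUnitUC_iff_isSemiboolean]
    exact he.isSemiboolean_iff_corner
  · intros
    exact FormalTriangular.isUnitUC_iff
  · exact isUnitUC_upperTriangularSubring_iff K n hn
  · exact KRing.isUnitUC_iff s
  · exact KRing.isUnitUC_two_iff
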